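/- Let $T>0$, $\omega=2\pi/T$, $n\in\mathbb N$; let $A:\mathbb R\to\mathbb R^{n\times n}$ and $Q:\mathbb R\to\mathbb C^{n\times n}$ be $T$-periodic and of class $L^\infty$. For a $T$-periodic $L^\infty$ matrix function $P$ let $P_{ij,k}=\frac1T\int_0^T P_{ij}(t)e^{-\mathrm i\omega kt}\,dt$ be its phasors, let $\mathcal T(P)$ be the $n\times n$ block matrix whose block $(i,j)$ is the infinite Toeplitz matrix $(P_{ij,k-l})_{k,l\in\mathbb Z}$, and let $\mathrm{col}(\mathbf P)$ be the vector of all phasors obtained by stacking the columns of $\mathbf P=(P_{ij,k})$. Put $\mathcal A=\mathcal T(A)$, $\mathcal Q=\mathcal T(Q)$, $\mathcal N=\mathrm{Id}_n\otimes\mathrm{diag}(\mathrm i\omega k)_{k\in\mathbb Z}$, and write $\mathrm{Id}_n\circ\mathcal M$ for the block matrix with blocks $\mathrm{Id}_n\otimes\mathcal M_{ij}$. Let $\mathcal A_m,\mathcal N_m$ be obtained from $\mathcal A,\mathcal N$ by keeping in every block only the indices $|k|,|l|\le m$, and let $\mathbf Q|_m$ consist of the phasors of $Q$ of order $|k|\le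 m$. Assume that $\mathcal A-\mathcal N$, on the domain $\{X\in\ell^2:(\mathcal A-\mathcal N)X\in\ell^2\}$, is invertible with bounded inverse on $\ell^2$, and that the harmonic Lyapunov equation $$\mathcal T(P)(\mathcal A-\mathcal N)+(\mathcal A-\mathcal N)^*\,\mathcal T(P)+\mathcal Q=0,\qquad P\in L^\infty,\ P\ T\text{-periodic},\tag{1}$$ satisfies uniqueness, i.e. for $Q=0$ its only solution is $P=0$ a.e. Then (1) has exactly one solution $P$ (up to a.e. equality); the operator $\mathrm{Id}_n\otimes(\mathcal A-\mathcal N)^*+\mathrm{Id}_n\circ\mathcal A^*$ is invertible on $\ell^2$ with bounded inverse, and $$\mathrm{col}(\mathbf P)=-\bigl(\mathrm{Id}_n\otimes(\mathcal A-\mathcal N)^*+\mathrm{Id}_n\circ\mathcal A^*\bigr)^{-1}\mathrm{col}(\mathbf Q).$$ Moreover, for every $\varepsilon>0$ there is $m_0$ such that for all $m\ge m_0$ the matrix $\mathrm{Id}_n\otimes(\mathcal A_m-\mathcal N_m)^*+\mathrm{Id}_n\circ\mathcal A_m^*$, of size $n^2(2m+1)$, is invertible, and the truncated solution $$\mathrm{col}(\tilde{\mathbf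 P}_m):=-\bigl(\mathrm{Id}_n\otimes(\mathcal A_m-\mathcal N_m)^*+\mathrm{Id}_n\circ\mathcal A_m^*\bigr)^{-1}\mathrm{col}(\mathbf Q|_m),$$ extended by $0$ to the phasors of order $|k|>m$, satisfies $$\|\mathrm{col}(\mathbf P-\tilde{\mathbf P}_m)\|_{\ell^2}<\varepsilon ;$$ and, with $\tilde P_m(t)=\sum_{|k|\le m}(\tilde{\mathbf P}_m)_k e^{\mathrm i\omega kt}$, the matrices $\mathcal T(P)$ and $\mathcal T(\tilde P_m)$ define bounded operators on $\ell^2$ with $$\|\mathcal T(P)-\mathcal T(\tilde P_m)\|_{\ell^2}<\varepsilon .$$ -/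

import Mathlib

open MeasureTheory
open scoped ENNReal Matrix Kronecker

namespace Harmonic

noncomputable section

/-- The complex Hilbert space `ℓ²` of square-summable families indexed by `κ`. -/
abbrev Ell2 (κ : Type) : Type := lp (fun _ : κ => ℂ) 2

/-- The (possibly infinite) matrix `M` sends the family `x` to the family `y`:
for every row `p`, the series `∑ q, M p q * x q` converges with sum `y p`. -/
def ActsTo {κ : Type} (M : Matrix κ κ ℂ) (x y : κ → ℂ) : Prop :=
  ∀ p, HasSum (fun q => M p q * x q) (y p)

/-- `L` is the bounded operator on `ℓ²` whose matrix is `M`. -/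
def IsOperatorOf {κ : Type} (M : Matrix κ κ ℂ) (L : Ell2 κ →L[ℂ] Ell2 κ) : Prop :=
  ∀ x : Ell2 κ, ActsTo M x (L x)

/-- Invertibility of the (possibly unbounded) operator on `ℓ²` defined by the matrix `M` on its
maximal domain `{x ∈ ℓ² : M x ∈ ℓ²}`: it has a bounded two-sided inverse `R : ℓ² → ℓ²`. -/
def IsInvertibleOp {κ : Type} (M : Matrix κ κ ℂ) : Prop :=
  ∃ R : Ell2 κ →L[ℂ] Ell2 κ,
    (∀ y : Ell2 κ, ActsTo M (R y) y) ∧ ∀ x y : Ell2 κ, ActsTo M x y → R y = x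

/-- `U` is the product `M * N` of two infinite matrices: every entry is a convergent series. -/
def IsProd {κ : Type} (M N U : Matrix κ κ ℂ) : Prop :=
  ∀ p q, HasSum (fun r => M p r * N r q) (U p q)

/-- Index set `{k ∈ ℤ : |k| ≤ m}` of the harmonics kept by the `m`-truncation. -/
abbrev Idx (m : ℕ) : Type := ↥(Finset.Icc (-(m : ℤ)) (m : ℤ))

variable {T : ℝ} [hT : Fact (0 < T)] {n : ℕ}

/-- A `T`-periodic matrix function (a function on the circle `ℝ / Tℤ`) of class `L^∞`. -/
def IsLInfty (P : AddCircle T → Matrix (Fin n) (Fin n) ℂ) : Prop :=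
  ∀ i j, MemLp (fun t => P t i j) ∞ (AddCircle.haarAddCircle (T := T))

/-- The complexification of a real matrix function. -/
def toC (A : AddCircle T → Matrix (Fin n) (Fin n) ℝ) : AddCircle T → Matrix (Fin n) (Fin n) ℂ :=
  fun t => (A t).map Complex.ofReal

/-- The `k`-th phasor `(1/T) ∫_0^T P i j (t) exp (-i ω k t) dt` of the entry `(i, j)`. -/
def phasor (P : AddCircle T → Matrix (Fin n) (Fin n) ℂ) (i j : Fin n) (k : ℤ) : ℂ :=
  fourierCoeff (fun t => P t i j) k

/-- The `n × n` block Toeplitz matrix `𝒯(P)`: the block `(i, j)` has entry `P_{ij, k - l}` at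
position `(k, l)`. -/
def toeplitz (P : AddCircle T → Matrix (Fin n) (Fin n) ℂ) :
    Matrix (Fin n × ℤ) (Fin n × ℤ) ℂ :=
  fun p q => phasor P p.1 q.1 (p.2 - q.2)

/-- `𝒩 = Id_n ⊗ diag (i ω k, k ∈ ℤ)` with `ω = 2 π / T`. -/
def nMat (T : ℝ) (n : ℕ) : Matrix (Fin n × ℤ) (Fin n × ℤ) ℂ :=
  (1 : Matrix (Fin n) (Fin n) ℂ) ⊗ₖ
    Matrix.diagonal (fun k : ℤ => Complex.I * ((2 * Real.pi / T : ℝ) : ℂ) * (k : ℂ))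

/-- `P`, of class `L^∞`, solves the harmonic Lyapunov equation
`𝒫 (𝒜 - 𝒩) + (𝒜 - 𝒩)ᴴ 𝒫 + 𝒬 = 0`, where `𝒜 = 𝒯(A)`, `𝒫 = 𝒯(P)`, `𝒬 = 𝒯(Q)`. -/
def IsLyapSol (A : AddCircle T → Matrix (Fin n) (Fin n) ℝ)
    (Q P : AddCircle T → Matrix (Fin n) (Fin n) ℂ) : Prop :=
  IsLInfty P ∧ ∃ U V : Matrix (Fin n × ℤ) (Fin n × ℤ) ℂ,
    IsProd (toeplitz P) (toeplitz (toC A) - nMat T n) U ∧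
    IsProd (toeplitz (toC A) - nMat T n)ᴴ (toeplitz P) V ∧
    U + V + toeplitz Q = 0

/-- `Id_n ∘ M`: the block matrix whose block `(j, j')` is `Id_n ⊗ M_{j j'}`, where `M_{j j'}`
are the blocks of `M`. -/
def idCirc {κ : Type} (M : Matrix (Fin n × κ) (Fin n × κ) ℂ) :
    Matrix (Fin n × (Fin n × κ)) (Fin n × (Fin n × κ)) ℂ :=
  fun p q =>
    ((1 : Matrix (Fin n) (Fin n) ℂ) ⊗ₖ (Matrix.of fun k l : κ => M (p.1, k) (q.1, l))) p.2 q.2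

/-- `Id_n ⊗ (𝒜 - 𝒩)ᴴ + Id_n ∘ 𝒜ᴴ`, acting on the vectorised phasors. -/
def lyapMat {κ : Type} (𝒜 𝒩 : Matrix (Fin n × κ) (Fin n × κ) ℂ) :
    Matrix (Fin n × (Fin n × κ)) (Fin n × (Fin n × κ)) ℂ :=
  (1 : Matrix (Fin n) (Fin n) ℂ) ⊗ₖ (𝒜 - 𝒩)ᴴ + idCirc 𝒜ᴴ

/-- `col(𝐏)`: the columns of the matrix of phasors stacked; `(j, (i, k))` is the `k`-th phasor of
the entry in row `i` and column `j`. -/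
def colPhasor (P : AddCircle T → Matrix (Fin n) (Fin n) ℂ) : Fin n × (Fin n × ℤ) → ℂ :=
  fun p => phasor P p.2.1 p.1 p.2.2

/-- The `m`-truncation of an `n × n` block matrix (every block is truncated to `|k|, |l| ≤ m`). -/
def trunc (m : ℕ) (M : Matrix (Fin n × ℤ) (Fin n × ℤ) ℂ) :
    Matrix (Fin n × Idx m) (Fin n × Idx m) ℂ :=
  M.submatrix (fun p => (p.1, (p.2 : ℤ))) (fun p => (p.1, (p.2 : ℤ)))

/-- `Id_n ⊗ (𝒜_m - 𝒩_m)ᴴ + Id_n ∘ 𝒜_mᴴ`, a square matrix of size `n² (2 m + 1)`. -/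
def truncLyapMat (A : AddCircle T → Matrix (Fin n) (Fin n) ℝ) (m : ℕ) :
    Matrix (Fin n × (Fin n × Idx m)) (Fin n × (Fin n × Idx m)) ℂ :=
  lyapMat (trunc m (toeplitz (toC A))) (trunc m (nMat T n))

/-- The solution `- (Id_n ⊗ (𝒜_m - 𝒩_m)ᴴ + Id_n ∘ 𝒜_mᴴ)⁻¹ col(𝐐|_m)` of the truncated system. -/
def truncSol (A : AddCircle T → Matrix (Fin n) (Fin n) ℝ)
    (Q : AddCircle T → Matrix (Fin n) (Fin n) ℂ) (m : ℕ) : Fin n × (Fin n × Idx m) → ℂ :=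
  -((truncLyapMat A m)⁻¹ *ᵥ fun p => colPhasor Q (p.1, (p.2.1, (p.2.2 : ℤ))))

/-- `col(𝐏̃_m)`: the truncated solution, extended by `0` to the phasors of order `|k| > m`. -/
def truncPhasor (A : AddCircle T → Matrix (Fin n) (Fin n) ℝ)
    (Q : AddCircle T → Matrix (Fin n) (Fin n) ℂ) (m : ℕ) : Fin n × (Fin n × ℤ) → ℂ :=
  fun p => if h : p.2.2 ∈ Finset.Icc (-(m : ℤ)) (m : ℤ) then
    truncSol A Q m (p.1, (p.2.1, ⟨p.2.2, h⟩)) else 0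

/-- The trigonometric polynomial `P̃_m(t) = ∑_{|k| ≤ m} (𝐏̃_m)_k exp (i ω k t)`. -/
def truncFun (A : AddCircle T → Matrix (Fin n) (Fin n) ℝ)
    (Q : AddCircle T → Matrix (Fin n) (Fin n) ℂ) (m : ℕ) :
    AddCircle T → Matrix (Fin n) (Fin n) ℂ :=
  fun t => Matrix.of fun i j =>
    ∑ k ∈ Finset.Icc (-(m : ℤ)) (m : ℤ), truncPhasor A Q m (j, (i, k)) * fourier k t

end

end Harmonic

/-! At the level of phasors the equation is `(B + N) x = -q`, where `B` is the bounded convolution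
operator of `P ↦ Aᵀ P + P A` and `N` is the diagonal `iωk`. Since `1 + iωk` never vanishes and grows
linearly, the diagonal `r = 1 / (1 + iωk)` is square-summable. Multiplication by `r` turns the
unbounded system into `(1 + diag(r) (B - 1)) x = -r q` on all of `ℓ²`
(`IsDiagPerturbation.actsTo_iff`).

The operator `diag(r)` is a norm limit of finite-rank operators, hence compact, and the Fredholm
alternative reduces invertibility to injectivity. A kernel element has the form `r z` with `z ∈ ℓ²`,
so it lies in `ℓ¹` by Cauchy–Schwarz and is the phasor family of a continuous matrix function. That
function solves the homogeneous Lyapunov equation and therefore vanishes (`isUnit_precondOp`). The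
same `ℓ¹` argument makes the solution for general `Q` a continuous function.

Truncation amounts to replacing `r` by its restriction to finitely many positions
(`IsDiagPerturbation.truncated_apply`). All truncated problems then live in one `ℓ²`, their
operators converge in norm, and continuity of inversion gives solvability and `ℓ²` convergence. As
each solution is `r` (or its restriction) times a convergent `ℓ²` family, convergence holds even in
`ℓ¹` (`tendsto_tsum_norm_precondSol_sub`). The `ℓ¹` norm of phasors dominates the sup norm of each
entry, hence the norm of the Toeplitz operators. -/

namespace Harmonic

noncomputable section

/-! ### Diagonal operators with square-summable diagonal -/

section Diagonal

open Filter Topology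

variable {κ : Type}

lemma two_toReal : (2 : ℝ≥0∞).toReal = 2 := by norm_num

lemma memℓp_two_of_norm_le {f : κ → ℂ} {c : ℝ} (x : Ell2 κ) (h : ∀ p, ‖f p‖ ≤ c * ‖x p‖) :
    Memℓp f 2 := by
  have hx := (memℓp_gen_iff (p := 2) (by norm_num)).1 (lp.memℓp x)
  refine memℓp_gen (Summable.of_nonneg_of_le (fun p => by positivity) (fun p => ?_)
    (hx.mul_left (c ^ (2 : ℝ))))
  rw [two_toReal, Real.rpow_two, Real.rpow_two, Real.rpow_two, ← mul_pow]
  exact pow_le_pow_left₀ (norm_nonneg _) (h p) 2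

lemma norm_le_mul_of_norm_le {f x : Ell2 κ} {c : ℝ} (hc : 0 ≤ c)
    (h : ∀ p, ‖f p‖ ≤ c * ‖x p‖) : ‖f‖ ≤ c * ‖x‖ := by
  refine lp.norm_le_of_forall_sum_le (by norm_num) (by positivity) fun s => ?_
  have hx := lp.sum_rpow_le_norm_rpow (p := 2) (by norm_num) x s
  rw [two_toReal] at *
  simp only [Real.rpow_two] at *
  rw [mul_pow]
  calc ∑ i ∈ s, ‖f i‖ ^ 2 ≤ ∑ i ∈ s, c ^ 2 * ‖x i‖ ^ 2 := by
        refine Finset.sum_le_sum fun i _ => ?_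
        rw [← mul_pow]
        exact pow_le_pow_left₀ (norm_nonneg _) (h i) 2
    _ ≤ c ^ 2 * ‖x‖ ^ 2 := by
        rw [← Finset.mul_sum]
        exact mul_le_mul_of_nonneg_left hx (by positivity)

lemma norm_mul_apply_le (r x : Ell2 κ) (p : κ) : ‖r p * x p‖ ≤ ‖r‖ * ‖x p‖ := by
  rw [norm_mul]
  exact mul_le_mul_of_nonneg_right (lp.norm_apply_le_norm (by norm_num) r p) (norm_nonneg _)

/-- The diagonal operator with square-summable diagonal `r`. -/
def diagOp : Ell2 κ →L[ℂ] Ell2 κ →L[ℂ] Ell2 κ :=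
  LinearMap.mkContinuous₂
    (LinearMap.mk₂ ℂ
      (fun r x => (⟨fun p => r p * x p, memℓp_two_of_norm_le x (norm_mul_apply_le r x)⟩ : Ell2 κ))
      (fun r s x => lp.ext <| funext fun p => add_mul (r p) (s p) (x p))
      (fun c r x => by ext p; simp [mul_assoc])
      (fun r x y => lp.ext <| funext fun p => mul_add (r p) (x p) (y p))
      (fun c r x => by ext p; simp [mul_left_comm]))
    1 (fun r x => by
      rw [one_mul]
      exact norm_le_mul_of_norm_le (norm_nonneg r) (norm_mul_apply_le r x))

@[simp] lemma diagOp_apply (r x : Ell2 κ) (p : κ) : diagOp r x p = r p * x p := rfl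

/-- Cauchy–Schwarz: the source of all `ℓ¹` regularity of solutions. -/
lemma summable_norm_mul (r x : Ell2 κ) : Summable fun p => ‖r p * x p‖ := by
  simp only [norm_mul]
  exact lp.summable_mul (p := 2) (q := 2) (by rw [two_toReal]; exact Real.HolderConjugate.two_two) r x

lemma tsum_norm_mul_le (r x : Ell2 κ) : ∑' p, ‖r p * x p‖ ≤ ‖r‖ * ‖x‖ := by
  simp only [norm_mul]
  exact lp.tsum_mul_le_mul_norm' (p := 2) (q := 2)
    (by rw [two_toReal]; exact Real.HolderConjugate.two_two) r x

lemma norm_mul_sub_mul_le (r s x y : Ell2 κ) (p : κ) :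
    ‖r p * x p - s p * y p‖ ≤ ‖r p * (x - y) p‖ + ‖(r - s) p * y p‖ := by
  have : r p * x p - s p * y p = r p * (x - y) p + (r - s) p * y p := by simp; ring
  rw [this]
  exact norm_add_le _ _

lemma summable_norm_mul_sub_mul (r s x y : Ell2 κ) :
    Summable fun p => ‖r p * x p - s p * y p‖ :=
  Summable.of_nonneg_of_le (fun _ => norm_nonneg _) (norm_mul_sub_mul_le r s x y)
    ((summable_norm_mul r (x - y)).add (summable_norm_mul (r - s) y))

lemma tendsto_tsum_norm_mul_sub_mul {ι : Type*} {l : Filter ι} {r x : Ell2 κ} {s y : ι → Ell2 κ}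
    (hs : Tendsto s l (𝓝 r)) (hy : Tendsto y l (𝓝 x)) :
    Tendsto (fun i => ∑' p, ‖r p * x p - s i p * y i p‖) l (𝓝 0) := by
  have h : Tendsto (fun i => ‖r‖ * ‖x - y i‖ + ‖r - s i‖ * ‖y i‖) l
      (𝓝 (‖r‖ * ‖x - x‖ + ‖r - r‖ * ‖x‖)) :=
    ((tendsto_const_nhds.sub hy).norm.const_mul _).add
      ((tendsto_const_nhds.sub hs).norm.mul hy.norm)
  simp only [sub_self, norm_zero, mul_zero, zero_mul, add_zero] at h
  refine squeeze_zero (fun _ => tsum_nonneg fun _ => norm_nonneg _) (fun i => ?_) h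
  have h1 := summable_norm_mul r (x - y i)
  have h2 := summable_norm_mul (r - s i) (y i)
  calc _ ≤ ∑' p, (‖r p * (x - y i) p‖ + ‖(r - s i) p * y i p‖) :=
        (summable_norm_mul_sub_mul r (s i) x (y i)).tsum_le_tsum
          (norm_mul_sub_mul_le r (s i) x (y i)) (h1.add h2)
    _ = _ := h1.tsum_add h2
    _ ≤ _ := add_le_add (tsum_norm_mul_le _ _) (tsum_norm_mul_le _ _)

@[simp] lemma evalCLM_apply (p : κ) (x : Ell2 κ) :
    lp.evalCLM ℂ (fun _ : κ => ℂ) 2 p x = x p := rfl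

lemma coe_sum_apply {ι : Type*} (s : Finset ι) (f : ι → Ell2 κ) (p : κ) :
    (∑ i ∈ s, f i : Ell2 κ) p = ∑ i ∈ s, f i p :=
  map_sum (lp.evalCLM ℂ (fun _ : κ => ℂ) 2 p) f s

open Classical in
/-- The restriction of `r` to the finite set `F`, extended by zero. -/
def restrictTo (F : Finset κ) (r : Ell2 κ) : Ell2 κ := ∑ p ∈ F, lp.single 2 p (r p)

open Classical in
lemma restrictTo_apply (F : Finset κ) (r : Ell2 κ) (p : κ) :
    restrictTo F r p = if p ∈ F then r p else 0 := by
  rw [restrictTo, coe_sum_apply]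
  simp [lp.single_apply, Pi.single_apply]

lemma tendsto_restrictTo (r : Ell2 κ) : Tendsto (fun F => restrictTo F r) atTop (𝓝 r) := by
  classical
  have := lp.hasSum_single (E := fun _ : κ => ℂ) (p := 2) (by norm_num) r
  rw [HasSum, SummationFilter.unconditional_filter] at this
  convert this using 2 with F
  rw [restrictTo]

/-- `diagOp` is continuous in its diagonal for the operator norm, so finite-rank cut-offs of `r`
approximate it. -/
lemma isCompactOperator_diagOp (r : Ell2 κ) : IsCompactOperator (diagOp r) := by
  classical
  refine isCompactOperator_of_tendsto (l := atTop) (F := fun F => diagOp (restrictTo F r))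
    ((diagOp.continuous.tendsto r).comp (tendsto_restrictTo r)) (Eventually.of_forall fun F => ?_)
  -- Each new position adds an operator that factors through evaluation into `ℂ`.
  induction F using Finset.induction_on with
  | empty => simpa [restrictTo] using isCompactOperator_zero
  | insert p F hp ih =>
    have h1 : IsCompactOperator (lp.evalCLM ℂ (fun _ : κ => ℂ) 2 p) :=
      isCompactOperator_of_locallyCompactSpace_dom _
    have h2 := h1.clm_comp (lp.singleContinuousLinearMap ℂ (fun _ : κ => ℂ) 2 p ∘L
      (r p • ContinuousLinearMap.id ℂ ℂ))
    refine (congrArg IsCompactOperator ?_).mp (h2.add ih)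
    ext x q
    change lp.single (E := fun _ : κ => ℂ) 2 p (r p * x p) q + restrictTo F r q * x q =
      restrictTo (insert p F) r q * x q
    by_cases hq : q = p
    · subst hq; simp [restrictTo_apply, hp]
    · simp [restrictTo_apply, hq]

end Diagonal

/-! ### Diagonal operators perturbed by bounded ones, and their truncations -/

section Perturbation

open Filter Topology

variable {κ : Type}

/-- The Fredholm alternative for `1 + diag(r) C`. -/
lemma isUnit_one_add_diagOp_comp (r : Ell2 κ) (C : Ell2 κ →L[ℂ] Ell2 κ)
    (hker : ∀ x : Ell2 κ, x + diagOp r (C x) = 0 → x = 0) :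
    IsUnit (1 + diagOp r ∘L C) := by
  have hK : IsCompactOperator (diagOp r ∘L C) := (isCompactOperator_diagOp r).comp_clm C
  rcases hK.hasEigenvalue_or_mem_resolventSet (μ := (-1 : ℂ)) (by norm_num) with h | h
  · obtain ⟨x, hx⟩ := h.exists_hasEigenvector
    refine absurd (hker x ?_) hx.2
    have := hx.apply_eq_smul
    simp only [ContinuousLinearMap.coe_coe, ContinuousLinearMap.comp_apply, neg_smul,
      one_smul] at this
    rw [this, add_neg_cancel]
  · rw [spectrum.mem_resolventSet_iff, ← IsUnit.neg_iff] at h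
    convert h using 1
    simp [add_comm]

lemma inverse_apply_eq {S : Ell2 κ →L[ℂ] Ell2 κ} (hS : IsUnit S) {x y : Ell2 κ} (h : S x = y) :
    Ring.inverse S y = x := by
  have := congrArg (fun L : Ell2 κ →L[ℂ] Ell2 κ => L x) (Ring.inverse_mul_cancel S hS)
  rw [← h]
  simpa using this

lemma apply_inverse {S : Ell2 κ →L[ℂ] Ell2 κ} (hS : IsUnit S) (y : Ell2 κ) :
    S (Ring.inverse S y) = y := by
  have := congrArg (fun L : Ell2 κ →L[ℂ] Ell2 κ => L y) (Ring.mul_inverse_cancel S hS)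
  simpa using this

/-- `M` is the matrix of the operator `diag(1/r) + C`. -/
def IsDiagPerturbation (M : Matrix κ κ ℂ) (r : Ell2 κ) (C : Ell2 κ →L[ℂ] Ell2 κ) : Prop :=
  (∀ p, r p ≠ 0) ∧ ∀ x : Ell2 κ, ActsTo M x fun p => x p / r p + C x p

variable {M : Matrix κ κ ℂ} {r : Ell2 κ} {C : Ell2 κ →L[ℂ] Ell2 κ}

/-- Row `p` is multiplied by `r p ≠ 0`, which is reversible; the maximal domain of `M` thus becomes
implicit in a bounded equation. -/
lemma IsDiagPerturbation.actsTo_iff (h : IsDiagPerturbation M r C) (x y : Ell2 κ) :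
    ActsTo M x y ↔ (1 + diagOp r ∘L C) x = diagOp r y := by
  have key : (1 + diagOp r ∘L C) x = diagOp r y ↔ ∀ p, x p / r p + C x p = y p := by
    rw [lp.ext_iff, funext_iff]
    refine forall_congr' fun p => ?_
    change x p + r p * C x p = r p * y p ↔ _
    have := h.1 p
    constructor
    · intro h'
      field_simp
      exact h'
    · intro h'
      rw [← h']
      field_simp
  rw [key]
  exact ⟨fun h' p => (h.2 x p).unique (h' p), fun h' p => h' p ▸ h.2 x p⟩

/-- Injectivity need only be tested on the range of `diagOp r`, because a kernel element satisfies
`x = diagOp r (-C x)`. -/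
lemma IsDiagPerturbation.isUnit (h : IsDiagPerturbation M r C)
    (hker : ∀ x z : Ell2 κ, x = diagOp r z → ActsTo M x (0 : Ell2 κ) → x = 0) :
    IsUnit (1 + diagOp r ∘L C) := by
  refine isUnit_one_add_diagOp_comp r C fun x hx => hker x (-C x) ?_ ?_
  · rw [map_neg]
    exact eq_neg_of_add_eq_zero_left hx
  · rw [h.actsTo_iff, map_zero]
    exact hx

lemma IsDiagPerturbation.isInvertibleOp (h : IsDiagPerturbation M r C)
    (hS : IsUnit (1 + diagOp r ∘L C)) : IsInvertibleOp M :=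
  ⟨Ring.inverse (1 + diagOp r ∘L C) ∘L diagOp r,
    fun y => (h.actsTo_iff _ y).2 (apply_inverse hS _),
    fun x y hxy => inverse_apply_eq hS ((h.actsTo_iff x y).1 hxy)⟩

/-- The finite-dimensional vector `v`, placed at the coordinates `e` and extended by zero. -/
def extendVec {α : Type} [Fintype α] [DecidableEq κ] (e : α → κ) (v : α → ℂ) : Ell2 κ :=
  ∑ a, lp.single 2 (e a) (v a)

section extendVec

variable {α : Type} [Fintype α] [DecidableEq κ] {e : α → κ} (he : Function.Injective e)

include he

lemma extendVec_apply (v : α → ℂ) (a : α) : extendVec e v (e a) = v a := by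
  classical
  rw [extendVec, coe_sum_apply]
  simp [lp.single_apply, Pi.single_apply, he.eq_iff]

omit he in
lemma extendVec_apply_of_notMem (v : α → ℂ) {p : κ} (hp : p ∉ Set.range e) :
    extendVec e v p = 0 := by
  rw [extendVec, coe_sum_apply]
  refine Finset.sum_eq_zero fun a _ => ?_
  rw [lp.single_apply, Pi.single_eq_of_ne]
  rintro rfl
  exact hp ⟨a, rfl⟩

lemma IsDiagPerturbation.submatrix_mulVec (h : IsDiagPerturbation M r C) (v : α → ℂ) (a : α) :
    (M.submatrix e e *ᵥ v) a = v a / r (e a) + C (extendVec e v) (e a) := by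
  classical
  have h1 := h.2 (extendVec e v) (e a)
  simp only [extendVec_apply he] at h1
  refine HasSum.unique ?_ h1
  refine (he.hasSum_iff fun p hp => ?_).1 ?_
  · rw [extendVec_apply_of_notMem v hp, mul_zero]
  · convert hasSum_fintype _ using 1
    exact Finset.sum_congr rfl fun b _ => by
      simp [Function.comp, extendVec_apply he]

/-- Cutting off `r` alone, and not `C`, already encodes the finite system: off `F` both sides
vanish, and on `F` this is the truncated row times `r`. -/
lemma IsDiagPerturbation.truncated_apply (h : IsDiagPerturbation M r C) (v : α → ℂ) {F : Finset κ}
    (hF : (F : Set κ) = Set.range e) :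
    (1 + diagOp (restrictTo F r) ∘L C) (extendVec e v) =
      diagOp (restrictTo F r) (extendVec e (M.submatrix e e *ᵥ v)) := by
  ext p
  change extendVec e v p + restrictTo F r p * C (extendVec e v) p =
    restrictTo F r p * extendVec e (M.submatrix e e *ᵥ v) p
  rw [restrictTo_apply]
  split_ifs with hp
  · rw [← Finset.mem_coe, hF] at hp
    obtain ⟨a, rfl⟩ := hp
    rw [extendVec_apply he, extendVec_apply he, h.submatrix_mulVec he]
    have := h.1 (e a)
    field_simp
  · rw [← Finset.mem_coe, hF] at hp
    simp [extendVec_apply_of_notMem v hp]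

lemma IsDiagPerturbation.isUnit_submatrix [DecidableEq α] (h : IsDiagPerturbation M r C)
    {F : Finset κ} (hF : (F : Set κ) = Set.range e)
    (hS : IsUnit (1 + diagOp (restrictTo F r) ∘L C)) : IsUnit (M.submatrix e e) := by
  rw [← Matrix.mulVec_injective_iff_isUnit]
  refine (injective_iff_map_eq_zero (M.submatrix e e).mulVecLin).2 fun v hv => ?_
  rw [Matrix.mulVecLin_apply] at hv
  have h1 := h.truncated_apply he v hF
  have h0 : extendVec e (0 : α → ℂ) = 0 := by simp [extendVec]
  rw [hv, h0, map_zero] at h1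
  have h2 := inverse_apply_eq hS h1
  rw [map_zero] at h2
  ext a
  rw [← extendVec_apply he v a, ← h2]
  rfl

lemma IsDiagPerturbation.extendVec_solution [DecidableEq α] (h : IsDiagPerturbation M r C)
    {F : Finset κ} (hF : (F : Set κ) = Set.range e)
    (hS : IsUnit (1 + diagOp (restrictTo F r) ∘L C)) (q : Ell2 κ) :
    extendVec e ((M.submatrix e e)⁻¹ *ᵥ fun a => q (e a)) =
      Ring.inverse (1 + diagOp (restrictTo F r) ∘L C) (diagOp (restrictTo F r) q) := by
  refine (inverse_apply_eq hS ?_).symm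
  rw [h.truncated_apply he _ hF, Matrix.mulVec_mulVec, Matrix.mul_nonsing_inv _
    ((Matrix.isUnit_iff_isUnit_det _).1 (h.isUnit_submatrix he hF hS)), Matrix.one_mulVec]
  ext p
  rw [diagOp_apply, diagOp_apply, restrictTo_apply]
  split_ifs with hp
  · rw [← Finset.mem_coe, hF] at hp
    obtain ⟨a, rfl⟩ := hp
    rw [extendVec_apply he]
  · simp

end extendVec

lemma tendsto_truncated (r : Ell2 κ) (C : Ell2 κ →L[ℂ] Ell2 κ) :
    Tendsto (fun F => 1 + diagOp (restrictTo F r) ∘L C) atTop (𝓝 (1 + diagOp r ∘L C)) :=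
  have h : Continuous fun s : Ell2 κ => 1 + diagOp s ∘L C :=
    continuous_const.add (diagOp.continuous.clm_comp continuous_const)
  (h.tendsto r).comp (tendsto_restrictTo r)

lemma eventually_isUnit_truncated (hS : IsUnit (1 + diagOp r ∘L C)) :
    ∀ᶠ F in atTop, IsUnit (1 + diagOp (restrictTo F r) ∘L C) :=
  (tendsto_truncated r C).eventually (Units.isOpen.mem_nhds hS)

/-- Inversion is continuous at a unit. `Ring.inverse` is total, so the family makes sense also for
those `F` where the truncated operator is singular. -/
lemma tendsto_solution_truncated (hS : IsUnit (1 + diagOp r ∘L C)) (q : Ell2 κ) :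
    Tendsto (fun F => Ring.inverse (1 + diagOp (restrictTo F r) ∘L C) (diagOp (restrictTo F r) q))
      atTop (𝓝 (Ring.inverse (1 + diagOp r ∘L C) (diagOp r q))) := by
  obtain ⟨u, hu⟩ := hS
  have h1 : Tendsto Ring.inverse (𝓝 (1 + diagOp r ∘L C))
      (𝓝 (Ring.inverse (1 + diagOp r ∘L C))) :=
    hu ▸ (NormedRing.inverse_continuousAt u)
  have h2 : Tendsto (fun F => diagOp (restrictTo F r) q) atTop (𝓝 (diagOp r q)) :=
    (((diagOp.flip q).continuous.tendsto r).comp (tendsto_restrictTo r) :)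
  exact (((isBoundedBilinearMap_apply (𝕜 := ℂ)).continuous.tendsto
    (Ring.inverse (1 + diagOp r ∘L C), diagOp r q)).comp
      ((h1.comp (tendsto_truncated r C)).prodMk_nhds h2) :)

/-- Fixed-point form of the solution, exhibiting it as `s` times an `ℓ²` family. -/
lemma inverse_diagOp_eq (s : Ell2 κ) (hS : IsUnit (1 + diagOp s ∘L C)) (q : Ell2 κ) :
    Ring.inverse (1 + diagOp s ∘L C) (diagOp s q) =
      diagOp s (q - C (Ring.inverse (1 + diagOp s ∘L C) (diagOp s q))) := by
  have := apply_inverse hS (diagOp s q)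
  rw [map_sub]
  exact eq_sub_of_add_eq this

end Perturbation

/-! ### Operators on `ℓ²` assembled from blocks -/

section Blocks

variable {κ ι : Type}

lemma sum_norm_sq_comp_le {e : ℤ → κ} (he : Function.Injective e) (x : Ell2 κ) (s : Finset ℤ) :
    ∑ k ∈ s, ‖x (e k)‖ ^ (2 : ℝ≥0∞).toReal ≤ ‖x‖ ^ (2 : ℝ≥0∞).toReal := by
  have hx := lp.sum_rpow_le_norm_rpow (p := 2) (by norm_num) x (s.map ⟨e, he⟩)
  rwa [Finset.sum_map] at hx

/-- Restriction of a square-summable family along an injective map. -/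
def restrictAlong (e : ℤ → κ) (he : Function.Injective e) : Ell2 κ →L[ℂ] Ell2 ℤ :=
  LinearMap.mkContinuous
    { toFun := fun x => ⟨fun k => x (e k), memℓp_gen' (sum_norm_sq_comp_le he x)⟩
      map_add' := fun _ _ => rfl
      map_smul' := fun _ _ => rfl }
    1 fun x => by
      rw [one_mul]
      exact lp.norm_le_of_forall_sum_le (by norm_num) (norm_nonneg _) (sum_norm_sq_comp_le he x)

@[simp] lemma restrictAlong_apply (e : ℤ → κ) (he : Function.Injective e) (x : Ell2 κ) (k : ℤ) :
    restrictAlong e he x k = x (e k) := rfl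

lemma norm_restrictAlong_le (e : ℤ → κ) (he : Function.Injective e) : ‖restrictAlong e he‖ ≤ 1 :=
  ContinuousLinearMap.opNorm_le_bound _ zero_le_one fun x => by
    rw [one_mul]
    exact lp.norm_le_of_forall_sum_le (by norm_num) (norm_nonneg _) (sum_norm_sq_comp_le he x)

/-- Placement of a square-summable family along an injective map, by zero elsewhere. -/
def placeAlong (e : ℤ → κ) (he : Function.Injective e) : Ell2 ℤ →L[ℂ] Ell2 κ :=
  ContinuousLinearMap.adjoint (restrictAlong e he)

lemma norm_placeAlong_le (e : ℤ → κ) (he : Function.Injective e) : ‖placeAlong e he‖ ≤ 1 := by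
  rw [placeAlong, LinearIsometryEquiv.norm_map]
  exact norm_restrictAlong_le e he

open Classical in
lemma placeAlong_eq_inner (e : ℤ → κ) (he : Function.Injective e) (x : Ell2 ℤ) (p : κ) :
    placeAlong e he x p = inner ℂ (restrictAlong e he (lp.single 2 p 1)) x := by
  rw [← ContinuousLinearMap.adjoint_inner_right]
  simp [lp.inner_single_left, placeAlong]

lemma placeAlong_apply (e : ℤ → κ) (he : Function.Injective e) (x : Ell2 ℤ) (k : ℤ) :
    placeAlong e he x (e k) = x k := by
  classical
  rw [placeAlong_eq_inner]
  have : restrictAlong e he (lp.single 2 (e k) 1) = lp.single 2 k 1 := by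
    ext l
    simp [lp.single_apply, Pi.single_apply, he.eq_iff]
  rw [this]
  simp [lp.inner_single_left]

lemma placeAlong_apply_of_ne (e : ℤ → κ) (he : Function.Injective e) (x : Ell2 ℤ) {p : κ}
    (hp : ∀ k, e k ≠ p) : placeAlong e he x p = 0 := by
  classical
  rw [placeAlong_eq_inner]
  have : restrictAlong e he (lp.single 2 p 1) = 0 := by
    ext l
    simp [lp.single_apply, hp l]
  rw [this, inner_zero_left]

variable (e : ι → ℤ → κ) (he : Function.Bijective fun p : ι × ℤ => e p.1 p.2)

include he

lemma injective_block (a : ι) : Function.Injective (e a) := fun k l h => by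
  simpa using @he.1 (a, k) (a, l) h

lemma block_ne {a b : ι} (h : b ≠ a) (k l : ℤ) : e b l ≠ e a k := fun h' =>
  h (congrArg Prod.fst (@he.1 (b, l) (a, k) h'))

variable [Fintype ι]

/-- `f` is the finite sum of its restrictions to the disjoint ranges of the `e b`. -/
lemma hasSum_of_blocks {E : Type*} [AddCommGroup E] [TopologicalSpace E] [IsTopologicalAddGroup E]
    {f : κ → E} {s : ι → E}
    (h : ∀ b, HasSum (fun l => f (e b l)) (s b)) : HasSum f (∑ b, s b) := by
  classical
  have h1 (b : ι) : HasSum (Set.indicator (Set.range (e b)) f) (s b) := by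
    rw [← (injective_block e he b).hasSum_iff fun x hx => Set.indicator_of_notMem hx f]
    convert h b using 2 with l
    exact Set.indicator_of_mem (Set.mem_range_self l) f
  convert hasSum_sum fun b (_ : b ∈ Finset.univ) => h1 b using 2 with p
  obtain ⟨⟨a, k⟩, rfl⟩ := he.2 p
  have hk : e a k ∈ Set.range (e a) := ⟨k, rfl⟩
  rw [Finset.sum_eq_single a]
  · exact (Set.indicator_of_mem hk f).symm
  · intro b _ hb
    refine Set.indicator_of_notMem ?_ f
    rintro ⟨l, hl⟩
    exact block_ne e he hb k l hl
  · simp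

/-- The operator whose blocks are the operators `L a b`. -/
def blockOp (L : ι → ι → Ell2 ℤ →L[ℂ] Ell2 ℤ) : Ell2 κ →L[ℂ] Ell2 κ :=
  ∑ a, ∑ b, placeAlong (e a) (injective_block e he a) ∘L L a b ∘L
    restrictAlong (e b) (injective_block e he b)

lemma blockOp_apply (L : ι → ι → Ell2 ℤ →L[ℂ] Ell2 ℤ) (x : Ell2 κ) (a : ι) (k : ℤ) :
    blockOp e he L x (e a k) =
      ∑ b, L a b (restrictAlong (e b) (injective_block e he b) x) k := by
  simp only [blockOp, sum_apply, ContinuousLinearMap.comp_apply]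
  rw [coe_sum_apply, Finset.sum_eq_single a]
  · rw [coe_sum_apply]
    simp only [placeAlong_apply]
  · intro b _ hb
    rw [coe_sum_apply]
    exact Finset.sum_eq_zero fun c _ =>
      placeAlong_apply_of_ne _ _ _ fun l => block_ne e he hb k l
  · simp

lemma norm_blockOp_le (L : ι → ι → Ell2 ℤ →L[ℂ] Ell2 ℤ) :
    ‖blockOp e he L‖ ≤ ∑ a, ∑ b, ‖L a b‖ := by
  refine (norm_sum_le _ _).trans (Finset.sum_le_sum fun a _ => (norm_sum_le _ _).trans
    (Finset.sum_le_sum fun b _ => ?_))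
  refine (ContinuousLinearMap.opNorm_comp_le _ _).trans ?_
  refine (mul_le_of_le_one_left (norm_nonneg _) (norm_placeAlong_le _ _)).trans ?_
  refine (ContinuousLinearMap.opNorm_comp_le _ _).trans ?_
  exact mul_le_of_le_one_right (norm_nonneg _) (norm_restrictAlong_le _ _)

lemma blockOp_sub (L L' : ι → ι → Ell2 ℤ →L[ℂ] Ell2 ℤ) :
    blockOp e he L - blockOp e he L' = blockOp e he fun a b => L a b - L' a b := by
  simp only [blockOp, ← Finset.sum_sub_distrib, ContinuousLinearMap.comp_sub,
    ContinuousLinearMap.sub_comp]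

lemma isOperatorOf_blockOp {L : ι → ι → Ell2 ℤ →L[ℂ] Ell2 ℤ} {M : Matrix κ κ ℂ}
    (h : ∀ a b, IsOperatorOf (fun k l => M (e a k) (e b l)) (L a b)) :
    IsOperatorOf M (blockOp e he L) := by
  intro x p
  obtain ⟨⟨a, k⟩, rfl⟩ := he.2 p
  rw [blockOp_apply]
  exact hasSum_of_blocks e he fun b => h a b (restrictAlong (e b) (injective_block e he b) x) k

end Blocks

/-! ### Laurent operators and absolutely convergent Fourier series -/

section Laurent

open AddCircle

variable {T : ℝ} [hT : Fact (0 < T)]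

/-- Multiplication by a bounded function, as an operator on the Fourier coefficients. -/
def laurent (f : Lp ℂ ∞ (haarAddCircle (T := T))) : Ell2 ℤ →L[ℂ] Ell2 ℤ :=
  (fourierBasis (T := T)).repr.toContinuousLinearEquiv.toContinuousLinearMap ∘L
    (ContinuousLinearMap.mul ℂ ℂ).holderL haarAddCircle ∞ 2 2 f ∘L
      (fourierBasis (T := T)).repr.symm.toContinuousLinearEquiv.toContinuousLinearMap

lemma laurent_apply (f : Lp ℂ ∞ (haarAddCircle (T := T))) (x : Ell2 ℤ) :
    laurent f x = fourierBasis.repr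
      ((ContinuousLinearMap.mul ℂ ℂ).holderL haarAddCircle ∞ 2 2 f (fourierBasis.repr.symm x)) :=
  rfl

lemma laurent_sub (f g : Lp ℂ ∞ (haarAddCircle (T := T))) :
    laurent (f - g) = laurent f - laurent g := by
  ext x : 1
  simp [laurent_apply, -ContinuousLinearMap.holderL_apply_apply]

lemma norm_laurent_le (f : Lp ℂ ∞ (haarAddCircle (T := T))) : ‖laurent f‖ ≤ ‖f‖ := by
  refine ContinuousLinearMap.opNorm_le_bound _ (norm_nonneg _) fun x => ?_
  rw [laurent_apply, LinearIsometryEquiv.norm_map, ContinuousLinearMap.holderL_apply_apply]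
  refine (ContinuousLinearMap.norm_holder_apply_apply_le _ _ _).trans ?_
  rw [LinearIsometryEquiv.norm_map]
  exact mul_le_mul_of_nonneg_right
    (mul_le_of_le_one_left (norm_nonneg _) (ContinuousLinearMap.opNorm_mul_le ℂ ℂ)) (norm_nonneg _)

lemma laurent_single (f : Lp ℂ ∞ (haarAddCircle (T := T))) (k l : ℤ) :
    laurent f (lp.single 2 l 1) k = fourierCoeff f (k - l) := by
  rw [laurent_apply, fourierBasis_repr, HilbertBasis.repr_symm_single, coe_fourierBasis,
    ContinuousLinearMap.holderL_apply_apply]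
  refine integral_congr_ae ?_
  filter_upwards [(ContinuousLinearMap.mul ℂ ℂ).coeFn_holder (r := 2) f (fourierLp 2 l),
    coeFn_fourierLp (T := T) 2 l] with t h1 h2
  rw [h1, h2, ContinuousLinearMap.mul_apply', smul_eq_mul, smul_eq_mul, neg_sub, sub_eq_add_neg,
    fourier_add]
  ring

lemma isOperatorOf_laurent (f : Lp ℂ ∞ (haarAddCircle (T := T))) :
    IsOperatorOf (fun k l => fourierCoeff f (k - l)) (laurent f) := by
  intro x k
  -- The continuous functional "`k`-th coordinate of `laurent f`" is applied termwise to the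
  -- expansion of `x` in unit vectors.
  have h := (lp.hasSum_single (E := fun _ : ℤ => ℂ) (p := 2) (by norm_num) x).mapL
    (lp.evalCLM ℂ (fun _ : ℤ => ℂ) 2 k ∘L laurent f)
  refine h.congr_fun fun l => ?_
  have : lp.single (E := fun _ : ℤ => ℂ) 2 l (x l) = x l • lp.single 2 l 1 := by
    rw [← lp.single_smul, smul_eq_mul, mul_one]
  rw [this, map_smul, ContinuousLinearMap.comp_apply, evalCLM_apply, laurent_single, smul_eq_mul,
    mul_comm]

lemma memℓp_fourierCoeff {f : AddCircle T → ℂ} (hf : MemLp f ∞ haarAddCircle) :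
    Memℓp (fourierCoeff f) 2 := by
  have h2 : MemLp f 2 haarAddCircle := hf.mono_exponent le_top
  have : fourierCoeff f = fourierBasis.repr (h2.toLp f) := by
    ext k
    rw [fourierBasis_repr]
    exact congrFun (fourierCoeff_congr_ae h2.coeFn_toLp.symm) k
  rw [this]
  exact lp.memℓp _

/-- The Laurent operator of a bounded function. -/
def mulOp {f : AddCircle T → ℂ} (hf : MemLp f ∞ haarAddCircle) : Ell2 ℤ →L[ℂ] Ell2 ℤ :=
  laurent (hf.toLp f)

lemma isOperatorOf_mulOp {f : AddCircle T → ℂ} (hf : MemLp f ∞ haarAddCircle) :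
    IsOperatorOf (fun k l => fourierCoeff f (k - l)) (mulOp hf) := by
  have h := isOperatorOf_laurent (hf.toLp f)
  have : fourierCoeff (hf.toLp f) = fourierCoeff f :=
    fourierCoeff_congr_ae hf.coeFn_toLp
  rwa [this] at h

/-- Reality of `A` makes the adjoint of its Toeplitz matrix the Toeplitz matrix of `Aᵀ`. -/
lemma conj_fourierCoeff_ofReal (f : AddCircle T → ℝ) (k : ℤ) :
    star (fourierCoeff (fun t => (f t : ℂ)) k) = fourierCoeff (fun t => (f t : ℂ)) (-k) := by
  simp only [fourierCoeff, RCLike.star_def]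
  rw [← integral_conj]
  congr 1
  ext t
  simp

/-- The continuous function with the given summable Fourier coefficients. -/
def synth (y : ℤ → ℂ) : C(AddCircle T, ℂ) := ∑' k, y k • fourier k

lemma summable_synth {y : ℤ → ℂ} (hy : Summable fun k => ‖y k‖) :
    Summable fun k => y k • (fourier k : C(AddCircle T, ℂ)) :=
  Summable.of_norm (by simpa [norm_smul, fourier_norm] using hy)

lemma norm_synth_le {y : ℤ → ℂ} (hy : Summable fun k => ‖y k‖) :
    ‖(synth y : C(AddCircle T, ℂ))‖ ≤ ∑' k, ‖y k‖ := by
  have : (fun k => ‖y k • (fourier k : C(AddCircle T, ℂ))‖) = fun k => ‖y k‖ := by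
    ext k; rw [norm_smul, fourier_norm, mul_one]
  rw [← this] at hy ⊢
  exact norm_tsum_le_tsum_norm hy

lemma synth_sub {y z : ℤ → ℂ} (hy : Summable fun k => ‖y k‖) (hz : Summable fun k => ‖z k‖) :
    (synth (fun k => y k - z k) : C(AddCircle T, ℂ)) = synth y - synth z := by
  simp only [synth, sub_smul]
  exact (summable_synth hy).tsum_sub (summable_synth hz)

/-- The `k`-th coefficient is a continuous functional of the function for the sup norm, through
`L²`, so it passes through the series. -/
lemma fourierCoeff_synth {y : ℤ → ℂ} (hy : Summable fun k => ‖y k‖) (k : ℤ) :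
    fourierCoeff (synth y : C(AddCircle T, ℂ)) k = y k := by
  have h := (summable_synth (T := T) hy).hasSum.mapL
    (lp.evalCLM ℂ (fun _ : ℤ => ℂ) 2 k ∘L
      (fourierBasis (T := T)).repr.toContinuousLinearEquiv.toContinuousLinearMap ∘L
      ContinuousMap.toLp (E := ℂ) 2 haarAddCircle ℂ)
  have key (g : C(AddCircle T, ℂ)) : (lp.evalCLM ℂ (fun _ : ℤ => ℂ) 2 k ∘L
      (fourierBasis (T := T)).repr.toContinuousLinearEquiv.toContinuousLinearMap ∘L
      ContinuousMap.toLp (E := ℂ) 2 haarAddCircle ℂ) g = fourierCoeff g k := by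
    change fourierBasis.repr (ContinuousMap.toLp (E := ℂ) 2 haarAddCircle ℂ g) k = _
    rw [fourierBasis_repr, fourierCoeff_toLp]
  rw [key] at h
  refine h.unique ?_
  have h1 : (fun l => (lp.evalCLM ℂ (fun _ : ℤ => ℂ) 2 k ∘L
      (fourierBasis (T := T)).repr.toContinuousLinearEquiv.toContinuousLinearMap ∘L
      ContinuousMap.toLp (E := ℂ) 2 haarAddCircle ℂ) (y l • fourier l)) =
      fun l => if l = k then y k else 0 := by
    ext l
    rw [map_smul, key, fourierCoeff_fourier]
    by_cases hl : l = k
    · subst hl; simp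
    · simp [hl, Ne.symm hl]
  rw [h1]
  exact hasSum_ite_eq k (y k)

lemma memLp_top_continuous (g : C(AddCircle T, ℂ)) : MemLp g ∞ haarAddCircle :=
  memLp_top_of_bound g.continuous.aestronglyMeasurable ‖g‖
    (Filter.Eventually.of_forall g.norm_coe_le_norm)

lemma norm_mulOp_sub_le (g g' : C(AddCircle T, ℂ)) :
    ‖mulOp (memLp_top_continuous g) - mulOp (memLp_top_continuous g')‖ ≤ ‖g - g'‖ := by
  rw [mulOp, mulOp, ← laurent_sub, ← MemLp.toLp_sub]
  refine (norm_laurent_le _).trans ?_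
  rw [Lp.norm_toLp]
  refine ENNReal.toReal_le_of_le_ofReal (norm_nonneg _) ?_
  rw [eLpNorm_exponent_top]
  exact eLpNormEssSup_le_of_ae_bound (Filter.Eventually.of_forall (g - g').norm_coe_le_norm)

end Laurent

/-! ### The Lyapunov matrix as a diagonal plus a bounded convolution -/

section Lyapunov

open AddCircle Filter Topology

variable {T : ℝ} {n : ℕ}

lemma IsOperatorOf.add {κ : Type} {M N : Matrix κ κ ℂ} {L L' : Ell2 κ →L[ℂ] Ell2 κ}
    (h : IsOperatorOf M L) (h' : IsOperatorOf N L') : IsOperatorOf (M + N) (L + L') := by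
  intro x p
  have := (h x p).add (h' x p)
  simp only [← add_mul] at this
  exact this

lemma isOperatorOf_zero {κ : Type} : IsOperatorOf (0 : Matrix κ κ ℂ) 0 := by
  intro x p
  simp

lemma IsOperatorOf.ite {κ : Type} {M : Matrix κ κ ℂ} {L : Ell2 κ →L[ℂ] Ell2 κ}
    (h : IsOperatorOf M L) (c : Prop) [Decidable c] :
    IsOperatorOf (if c then M else 0) (if c then L else 0) := by
  split_ifs
  · exact h
  · exact isOperatorOf_zero

lemma bijective_block : Function.Bijective fun p : Fin n × ℤ => Prod.mk p.1 p.2 :=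
  Function.bijective_id

/-- The position of the `k`-th phasor of the entry in row `p.2` and column `p.1`. -/
def colIndex (p : Fin n × Fin n) (k : ℤ) : Fin n × (Fin n × ℤ) := (p.1, (p.2, k))

lemma bijective_colIndex :
    Function.Bijective fun p : (Fin n × Fin n) × ℤ => colIndex p.1 p.2 :=
  (Equiv.prodAssoc (Fin n) (Fin n) ℤ).bijective

/-- The angular frequency `i ω k`. -/
def freq (T : ℝ) (k : ℤ) : ℂ := Complex.I * ((2 * Real.pi / T : ℝ) : ℂ) * (k : ℂ)

lemma star_freq (k : ℤ) : star (freq T k) = -freq T k := by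
  simp [freq]

lemma nMat_apply (p q : Fin n × ℤ) : nMat T n p q = if p = q then freq T q.2 else 0 := by
  rw [nMat, Matrix.kroneckerMap_apply, Matrix.one_apply, Matrix.diagonal_apply]
  by_cases h1 : p.1 = q.1 <;> by_cases h2 : p.2 = q.2 <;> simp [Prod.ext_iff, h1, h2, freq]

/-- The real part is 1. The shift by 1 is needed because the frequency `k = 0` gives 0. -/
lemma one_add_freq_ne_zero (k : ℤ) : 1 + freq T k ≠ 0 := by
  intro h
  have := congrArg Complex.re h
  simp [freq] at this

variable [hT : Fact (0 < T)]

lemma star_phasor_toC (A : AddCircle T → Matrix (Fin n) (Fin n) ℝ) (i j : Fin n) (k : ℤ) :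
    star (phasor (toC A) i j k) = phasor (toC A) i j (-k) :=
  conj_fourierCoeff_ofReal (fun t => A t i j) k

/-- The bounded part of the Lyapunov matrix. -/
def convMat (A : AddCircle T → Matrix (Fin n) (Fin n) ℝ) :
    Matrix (Fin n × (Fin n × ℤ)) (Fin n × (Fin n × ℤ)) ℂ := fun p q =>
  (if p.1 = q.1 then phasor (toC A) q.2.1 p.2.1 (p.2.2 - q.2.2) else 0) +
    if p.2.1 = q.2.1 then phasor (toC A) q.1 p.1 (p.2.2 - q.2.2) else 0

lemma lyapMat_apply (A : AddCircle T → Matrix (Fin n) (Fin n) ℝ) (p q : Fin n × (Fin n × ℤ)) :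
    lyapMat (toeplitz (toC A)) (nMat T n) p q =
      convMat A p q + if p = q then freq T q.2.2 else 0 := by
  obtain ⟨j, i, k⟩ := p
  obtain ⟨j', i', k'⟩ := q
  simp only [lyapMat, idCirc, convMat, Matrix.add_apply, Matrix.kroneckerMap_apply,
    Matrix.one_apply, Matrix.conjTranspose_apply, Matrix.sub_apply, star_sub, nMat_apply, toeplitz,
    star_phasor_toC, Matrix.of_apply, neg_sub]
  -- The adjoint of `-𝒩` is `𝒩`, its entries being purely imaginary.
  have : (if (j, i, k) = (j', i', k') then freq T k' else 0) =
      (if j = j' then (1 : ℂ) else 0) * -star (if (i', k') = (i, k) then freq T k else 0) := by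
    by_cases h1 : j = j' <;> by_cases h2 : i = i' <;> by_cases h3 : k = k' <;>
      simp [h1, h2, h3, star_freq, eq_comm]
  rw [this]
  split_ifs <;> ring

/-- The bounded operator with matrix `convMat A`. -/
def convOp {A : AddCircle T → Matrix (Fin n) (Fin n) ℝ} (hA : IsLInfty (toC A)) :
    Ell2 (Fin n × (Fin n × ℤ)) →L[ℂ] Ell2 (Fin n × (Fin n × ℤ)) :=
  blockOp colIndex bijective_colIndex fun a b =>
    (if a.1 = b.1 then mulOp (hA b.2 a.2) else 0) + if a.2 = b.2 then mulOp (hA b.1 a.1) else 0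

lemma isOperatorOf_convOp {A : AddCircle T → Matrix (Fin n) (Fin n) ℝ} (hA : IsLInfty (toC A)) :
    IsOperatorOf (convMat A) (convOp hA) := by
  refine isOperatorOf_blockOp _ _ fun a b => ?_
  have h := ((isOperatorOf_mulOp (hA b.2 a.2)).ite (a.1 = b.1)).add
    ((isOperatorOf_mulOp (hA b.1 a.1)).ite (a.2 = b.2))
  have hM : (fun k l => convMat A (colIndex a k) (colIndex b l)) =
      (if a.1 = b.1 then fun k l : ℤ => fourierCoeff (fun t => toC A t b.2 a.2) (k - l) else 0) +
      if a.2 = b.2 then fun k l : ℤ => fourierCoeff (fun t => toC A t b.1 a.1) (k - l) else 0 := by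
    ext k l
    by_cases h1 : a.1 = b.1 <;> by_cases h2 : a.2 = b.2 <;>
      simp only [convMat, colIndex, h1, h2, if_true, if_false] <;> rfl
  rw [hM]
  exact h

lemma summable_inv_sq (T : ℝ) [hT : Fact (0 < T)] :
    Summable fun k : ℤ => ‖(1 + freq T k)⁻¹‖ ^ 2 := by
  have hω : 0 < 2 * Real.pi / T := div_pos Real.two_pi_pos hT.out
  have hsum := (Real.summable_one_div_int_pow (p := 2)).2 (by norm_num)
  refine Summable.of_norm_bounded_eventually (g := fun k : ℤ =>
    ((2 * Real.pi / T) ^ 2)⁻¹ * (1 / (k : ℝ) ^ 2)) (hsum.mul_left _) ?_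
  -- At `k = 0` the comparison fails, since there `1 / k ^ 2` takes the default value 0.
  filter_upwards [(Set.finite_singleton (0 : ℤ)).compl_mem_cofinite] with k hk
  have hk : (k : ℝ) ≠ 0 := by exact_mod_cast hk
  have h1 : ‖1 + freq T k‖ ^ 2 = 1 + (2 * Real.pi / T) ^ 2 * (k : ℝ) ^ 2 := by
    rw [← Complex.normSq_eq_norm_sq, Complex.normSq_apply]
    simp [freq]
    ring
  rw [norm_pow, norm_norm, norm_inv, inv_pow, h1, one_div, ← mul_inv]
  exact inv_anti₀ (by positivity) (by linarith)

/-- The diagonal of `(1 + 𝒩)⁻¹`. -/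
def resolventDiag (T : ℝ) [hT : Fact (0 < T)] (n : ℕ) : Ell2 (Fin n × (Fin n × ℤ)) :=
  ⟨fun p => (1 + freq T p.2.2)⁻¹, memℓp_gen (by
    simp only [two_toReal, Real.rpow_two]
    exact (hasSum_of_blocks (f := fun p : Fin n × (Fin n × ℤ) => ‖(1 + freq T p.2.2)⁻¹‖ ^ 2)
      colIndex bijective_colIndex fun _ => (summable_inv_sq T).hasSum).summable)⟩

/-- The splitting `𝒩 + ℬ = (1 + 𝒩) + (ℬ - 1)`. -/
lemma isDiagPerturbation_lyapMat {A : AddCircle T → Matrix (Fin n) (Fin n) ℝ}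
    (hA : IsLInfty (toC A)) :
    IsDiagPerturbation (lyapMat (toeplitz (toC A)) (nMat T n)) (resolventDiag T n)
      (convOp hA - 1) := by
  refine ⟨fun p => inv_ne_zero (one_add_freq_ne_zero _), fun x p => ?_⟩
  have h1 := isOperatorOf_convOp hA x p
  have h2 := hasSum_ite_eq p (freq T p.2.2 * x p)
  convert h1.add h2 using 1
  · ext q
    rw [lyapMat_apply, add_mul]
    congr 1
    by_cases h : q = p
    · subst h; simp
    · simp [h, Ne.symm h]
  · change x p / (1 + freq T p.2.2)⁻¹ + (convOp hA x p - x p) = _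
    rw [div_inv_eq_mul]
    ring

end Lyapunov

/-! ### From the vectorised system to the harmonic Lyapunov equation -/

section Equation

open AddCircle Filter Topology

variable {T : ℝ} [hT : Fact (0 < T)] {n : ℕ}

/-- The square-summable phasors of one entry of a bounded matrix function. -/
def entryVec {P : AddCircle T → Matrix (Fin n) (Fin n) ℂ} (hP : IsLInfty P) (i j : Fin n) :
    Ell2 ℤ := ⟨phasor P i j, memℓp_fourierCoeff (hP i j)⟩

/-- The square-summable phasors of a bounded matrix function. -/
def colVec {P : AddCircle T → Matrix (Fin n) (Fin n) ℂ} (hP : IsLInfty P) :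
    Ell2 (Fin n × (Fin n × ℤ)) :=
  ⟨colPhasor P, memℓp_gen (hasSum_of_blocks
    (f := fun p => ‖colPhasor P p‖ ^ (2 : ℝ≥0∞).toReal)
    colIndex bijective_colIndex fun a =>
      ((memℓp_gen_iff (by norm_num)).1 (memℓp_fourierCoeff (hP a.2 a.1))).hasSum).summable⟩

lemma hasSum_phasor_mul {A P : AddCircle T → Matrix (Fin n) (Fin n) ℂ} (hA : IsLInfty A)
    (hP : IsLInfty P) (i j i' j' : Fin n) (k : ℤ) :
    HasSum (fun s => phasor A i j (k - s) * phasor P i' j' s)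
      (mulOp (hA i j) (entryVec hP i' j') k) :=
  isOperatorOf_mulOp (hA i j) (entryVec hP i' j') k

variable {A : AddCircle T → Matrix (Fin n) (Fin n) ℝ} {P : AddCircle T → Matrix (Fin n) (Fin n) ℂ}

/-- The phasors of `Aᵀ P`. -/
def leftConv (hA : IsLInfty (toC A)) (hP : IsLInfty P) (i j : Fin n) (k : ℤ) : ℂ :=
  ∑ r, mulOp (hA r i) (entryVec hP r j) k

/-- The phasors of `P A`. -/
def rightConv (hA : IsLInfty (toC A)) (hP : IsLInfty P) (i j : Fin n) (k : ℤ) : ℂ :=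
  ∑ r, mulOp (hA r j) (entryVec hP i r) k

lemma convOp_colVec (hA : IsLInfty (toC A)) (hP : IsLInfty P) (i j : Fin n) (k : ℤ) :
    convOp hA (colVec hP) (j, (i, k)) = leftConv hA hP i j k + rightConv hA hP i j k := by
  have h := blockOp_apply colIndex bijective_colIndex (fun a b : Fin n × Fin n =>
    (if a.1 = b.1 then mulOp (hA b.2 a.2) else 0) + if a.2 = b.2 then mulOp (hA b.1 a.1) else 0)
    (colVec hP) (j, i) k
  refine h.trans ?_
  have hr (b : Fin n × Fin n) : restrictAlong (colIndex b)
      (injective_block colIndex bijective_colIndex b) (colVec hP) = entryVec hP b.2 b.1 := rfl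
  simp only [hr]
  have hs (b : Fin n × Fin n) :
      (((if j = b.1 then mulOp (hA b.2 i) else 0) + if i = b.2 then mulOp (hA b.1 j) else 0)
        (entryVec hP b.2 b.1) : Ell2 ℤ) k =
      (if j = b.1 then mulOp (hA b.2 i) (entryVec hP b.2 b.1) k else 0) +
        if i = b.2 then mulOp (hA b.1 j) (entryVec hP b.2 b.1) k else 0 := by
    split_ifs <;> simp
  rw [Finset.sum_congr rfl fun b _ => hs b, Finset.sum_add_distrib, Fintype.sum_prod_type,
    Fintype.sum_prod_type]
  simp [leftConv, rightConv]

/-- The two contributions of `𝒩` at `(k, l)` combine to `iωk - iωl = iω(k - l)`. The whole equation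
is therefore Toeplitz, and its entry at `(k, l)` is the vectorised equation at order `k - l`. -/
lemma isLyapSol_of_actsTo (hA : IsLInfty (toC A)) (hP : IsLInfty P)
    {Q : AddCircle T → Matrix (Fin n) (Fin n) ℂ}
    (h : ActsTo (lyapMat (toeplitz (toC A)) (nMat T n)) (colPhasor P) (-colPhasor Q)) :
    IsLyapSol A Q P := by
  have heq (i j : Fin n) (k : ℤ) :
      leftConv hA hP i j k + rightConv hA hP i j k + freq T k * phasor P i j k =
        -phasor Q i j k := by
    have h1 := ((isDiagPerturbation_lyapMat hA).2 (colVec hP) (j, (i, k))).unique (h (j, (i, k)))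
    rw [← convOp_colVec]
    have h2 : phasor P i j k / (1 + freq T k)⁻¹ +
      (convOp hA (colVec hP) (j, (i, k)) - phasor P i j k) = -phasor Q i j k := h1
    rw [div_inv_eq_mul] at h2
    rw [← h2]
    ring
  refine ⟨hP, fun p q => rightConv hA hP p.1 q.1 (p.2 - q.2) -
      freq T q.2 * phasor P p.1 q.1 (p.2 - q.2),
    fun p q => leftConv hA hP p.1 q.1 (p.2 - q.2) + freq T p.2 * phasor P p.1 q.1 (p.2 - q.2),
    ?_, ?_, ?_⟩
  · rintro ⟨i, k⟩ ⟨j, l⟩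
    have h1 := hasSum_of_blocks
      (f := fun r : Fin n × ℤ => phasor (toC A) r.1 j (r.2 - l) * phasor P i r.1 (k - r.2))
      Prod.mk bijective_block fun r => by
        -- The substitution `s = k - r.2` turns the matrix product into a convolution.
        refine ((Equiv.subLeft k).hasSum_iff).1 ?_
        refine (hasSum_phasor_mul hA hP r j i r (k - l)).congr_fun fun s => ?_
        simp only [Function.comp, Equiv.subLeft_apply]
        congr 2 <;> ring
    have h2 := hasSum_ite_eq ((j, l) : Fin n × ℤ) (freq T l * phasor P i j (k - l))
    refine (h1.sub h2).congr_fun fun r => ?_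
    simp only [Matrix.sub_apply, nMat_apply, toeplitz]
    by_cases hr : r = (j, l)
    · subst hr; simp; ring
    · simp [hr, mul_comm]
  · rintro ⟨i, k⟩ ⟨j, l⟩
    have h1 := hasSum_of_blocks
      (f := fun r : Fin n × ℤ => phasor (toC A) r.1 i (k - r.2) * phasor P r.1 j (r.2 - l))
      Prod.mk bijective_block fun r => by
        refine ((Equiv.addRight l).hasSum_iff).1 ?_
        refine (hasSum_phasor_mul hA hP r i r j (k - l)).congr_fun fun s => ?_
        simp only [Function.comp, Equiv.coe_addRight]
        congr 2 <;> ring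
    have h2 := hasSum_ite_eq ((i, k) : Fin n × ℤ) (freq T k * phasor P i j (k - l))
    refine (h1.add h2).congr_fun fun r => ?_
    simp only [Matrix.conjTranspose_apply, Matrix.sub_apply, star_sub, nMat_apply, toeplitz,
      star_phasor_toC, neg_sub]
    by_cases hr : r = (i, k)
    · subst hr; simp [star_freq]; ring
    · simp [hr]
  · ext p q
    have := heq p.1 q.1 (p.2 - q.2)
    have hf : freq T (p.2 - q.2) = freq T p.2 - freq T q.2 := by simp [freq]; ring
    rw [hf] at this
    change rightConv hA hP p.1 q.1 (p.2 - q.2) - freq T q.2 * phasor P p.1 q.1 (p.2 - q.2) +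
      (leftConv hA hP p.1 q.1 (p.2 - q.2) + freq T p.2 * phasor P p.1 q.1 (p.2 - q.2)) +
      phasor Q p.1 q.1 (p.2 - q.2) = 0
    linear_combination this

/-- Linearity, which extends uniqueness from `Q = 0` to every `Q`. -/
lemma IsLyapSol.sub {Q P' : AddCircle T → Matrix (Fin n) (Fin n) ℂ} (h' : IsLyapSol A Q P')
    (h : IsLyapSol A Q P) : IsLyapSol A (fun _ => 0) (fun t => P' t - P t) := by
  obtain ⟨hP', U', V', hU', hV', he'⟩ := h'
  obtain ⟨hP, U, V, hU, hV, he⟩ := h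
  have ht : toeplitz (fun t => P' t - P t) = toeplitz P' - toeplitz P := by
    ext p q
    have h1 := (hP' p.1 q.1).integrable le_top
    have h2 := (hP p.1 q.1).integrable le_top
    simp only [toeplitz, phasor, Matrix.sub_apply]
    simp only [fourierCoeff, smul_sub]
    exact integral_sub (h1.fourier_smul _) (h2.fourier_smul _)
  have h0 : toeplitz (fun _ : AddCircle T => (0 : Matrix (Fin n) (Fin n) ℂ)) = 0 := by
    ext p q
    simp [toeplitz, phasor, fourierCoeff]
  refine ⟨fun i j => (hP' i j).sub (hP i j), U' - U, V' - V, fun p q => ?_, fun p q => ?_, ?_⟩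
  · rw [ht]
    simpa only [Matrix.sub_apply, sub_mul] using (hU' p q).sub (hU p q)
  · rw [ht]
    simpa only [Matrix.sub_apply (toeplitz P'), Matrix.sub_apply V', mul_sub] using
      (hV' p q).sub (hV p q)
  · rw [h0, add_zero, ← sub_eq_zero.2 (he'.trans he.symm)]
    abel

end Equation

/-! ### Matrix functions with summable phasors, and the index sets of truncation -/

section Synthesis

open AddCircle Filter Topology

variable {T : ℝ} [hT : Fact (0 < T)] {n : ℕ}

/-- The matrix function with the given summable phasors. -/
def synthMat (x : Fin n × (Fin n × ℤ) → ℂ) : AddCircle T → Matrix (Fin n) (Fin n) ℂ :=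
  fun t => Matrix.of fun i j => synth (fun k => x (j, (i, k))) t

lemma isLInfty_synthMat (x : Fin n × (Fin n × ℤ) → ℂ) : IsLInfty (synthMat (T := T) x) :=
  fun i j => memLp_top_continuous (synth fun k => x (j, (i, k)))

lemma summable_block {x : Fin n × (Fin n × ℤ) → ℂ} (hx : Summable fun p => ‖x p‖) (i j : Fin n) :
    Summable fun k => ‖x (j, (i, k))‖ :=
  hx.comp_injective (injective_block colIndex bijective_colIndex (j, i))

lemma colPhasor_synthMat {x : Fin n × (Fin n × ℤ) → ℂ} (hx : Summable fun p => ‖x p‖) :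
    colPhasor (synthMat (T := T) x) = x := by
  ext ⟨j, i, k⟩
  exact fourierCoeff_synth (summable_block hx i j) k

/-- The bounded operator `𝒯(P)` for the matrix function `P` with the given phasors. -/
def toeplitzOp (T : ℝ) [hT : Fact (0 < T)] (x : Fin n × (Fin n × ℤ) → ℂ) :
    Ell2 (Fin n × ℤ) →L[ℂ] Ell2 (Fin n × ℤ) :=
  blockOp Prod.mk bijective_block fun i j => mulOp (isLInfty_synthMat (T := T) x i j)

lemma isOperatorOf_toeplitzOp (x : Fin n × (Fin n × ℤ) → ℂ) :
    IsOperatorOf (toeplitz (synthMat (T := T) x)) (toeplitzOp T x) :=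
  isOperatorOf_blockOp _ _ fun i j => isOperatorOf_mulOp (isLInfty_synthMat (T := T) x i j)

/-- Each block is bounded by the sup norm of its symbol, hence by the `ℓ¹` norm of the phasors; an
`ℓ²` estimate would not suffice. -/
lemma norm_toeplitzOp_sub_le {x y : Fin n × (Fin n × ℤ) → ℂ} (hx : Summable fun p => ‖x p‖)
    (hy : Summable fun p => ‖y p‖) :
    ‖toeplitzOp T x - toeplitzOp T y‖ ≤ ∑' p, ‖x p - y p‖ := by
  have hxy : Summable fun p => ‖x p - y p‖ :=
    Summable.of_nonneg_of_le (fun _ => norm_nonneg _) (fun _ => norm_sub_le _ _) (hx.add hy)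
  rw [toeplitzOp, toeplitzOp, blockOp_sub]
  refine (norm_blockOp_le _ _ _).trans ?_
  have hsum := hasSum_of_blocks (f := fun p => ‖x p - y p‖) colIndex bijective_colIndex
    fun a => (summable_block (x := fun p => x p - y p) hxy a.2 a.1).hasSum
  rw [hsum.tsum_eq, Fintype.sum_prod_type_right]
  refine Finset.sum_le_sum fun i _ => Finset.sum_le_sum fun j _ => ?_
  refine (norm_mulOp_sub_le (T := T) (synth fun k => x (j, (i, k)))
    (synth fun k => y (j, (i, k)))).trans ?_
  rw [← synth_sub (summable_block hx i j) (summable_block hy i j)]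
  exact norm_synth_le (summable_block (x := fun p => x p - y p) hxy i j)

lemma truncFun_eq_synthMat (A : AddCircle T → Matrix (Fin n) (Fin n) ℝ)
    (Q : AddCircle T → Matrix (Fin n) (Fin n) ℂ) (m : ℕ) :
    truncFun A Q m = synthMat (truncPhasor A Q m) := by
  ext t i j
  rw [truncFun, synthMat, Matrix.of_apply, Matrix.of_apply, synth,
    tsum_eq_sum (s := Finset.Icc (-(m : ℤ)) (m : ℤ)) fun k hk => by
      simp [truncPhasor, -Finset.mem_Icc, hk]]
  simp

/-- The positions kept by the `m`-truncation. -/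
def truncIndex (m : ℕ) (p : Fin n × (Fin n × Idx m)) : Fin n × (Fin n × ℤ) :=
  (p.1, (p.2.1, (p.2.2 : ℤ)))

lemma injective_truncIndex (m : ℕ) : Function.Injective (truncIndex (n := n) m) := by
  rintro ⟨j, i, k⟩ ⟨j', i', k'⟩ h
  simp only [truncIndex, Prod.mk.injEq, SetLike.coe_eq_coe] at h
  simp [h]

lemma mem_range_truncIndex (m : ℕ) (p : Fin n × (Fin n × ℤ)) :
    p ∈ Set.range (truncIndex m) ↔ p.2.2 ∈ Finset.Icc (-(m : ℤ)) (m : ℤ) := by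
  constructor
  · rintro ⟨⟨j, i, k⟩, rfl⟩
    exact k.2
  · intro h
    exact ⟨(p.1, (p.2.1, ⟨p.2.2, h⟩)), rfl⟩

/-- The finite set of positions kept by the `m`-truncation. -/
def truncSet (n m : ℕ) : Finset (Fin n × (Fin n × ℤ)) :=
  Finset.univ ×ˢ (Finset.univ ×ˢ Finset.Icc (-(m : ℤ)) (m : ℤ))

lemma coe_truncSet (m : ℕ) : (truncSet n m : Set (Fin n × (Fin n × ℤ))) =
    Set.range (truncIndex m) := by
  ext p
  rw [mem_range_truncIndex]
  simp [truncSet]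

lemma tendsto_truncSet : Tendsto (truncSet n) atTop atTop := by
  refine tendsto_atTop_finset_of_monotone (fun m m' h p hp => ?_) fun p => ⟨p.2.2.natAbs, ?_⟩
  · simp only [truncSet, Finset.mem_product, Finset.mem_univ, Finset.mem_Icc, true_and] at hp ⊢
    omega
  · simp only [truncSet, Finset.mem_product, Finset.mem_univ, Finset.mem_Icc, true_and]
    omega

/-- Truncation commutes with `lyapMat` because no matrix product enters: each entry uses only
entries of `𝒜` and `𝒩` at the same harmonics. -/
lemma truncLyapMat_eq_submatrix (A : AddCircle T → Matrix (Fin n) (Fin n) ℝ) (m : ℕ) :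
    truncLyapMat A m = (lyapMat (toeplitz (toC A)) (nMat T n)).submatrix
      (truncIndex m) (truncIndex m) := by
  ext p q
  rfl

lemma truncPhasor_eq_extendVec (A : AddCircle T → Matrix (Fin n) (Fin n) ℝ)
    (Q : AddCircle T → Matrix (Fin n) (Fin n) ℂ) (m : ℕ) :
    truncPhasor A Q m = extendVec (truncIndex m) (truncSol A Q m) := by
  ext p
  by_cases hp : p.2.2 ∈ Finset.Icc (-(m : ℤ)) (m : ℤ)
  · rw [truncPhasor, dif_pos hp]
    exact (extendVec_apply (injective_truncIndex m) (truncSol A Q m)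
      (p.1, (p.2.1, ⟨p.2.2, hp⟩))).symm
  · rw [truncPhasor, dif_neg hp, extendVec_apply_of_notMem]
    rwa [mem_range_truncIndex]

end Synthesis

/-! ### Invertibility, and convergence in `ℓ²` and `ℓ¹` -/

section Convergence

open AddCircle Filter Topology

variable {T : ℝ} [hT : Fact (0 < T)] {n : ℕ} {A : AddCircle T → Matrix (Fin n) (Fin n) ℝ}
  {Q : AddCircle T → Matrix (Fin n) (Fin n) ℂ}

/-- The preconditioned Lyapunov operator `1 + diag(s) (ℬ - 1)`, where `ℬ` is the bounded part. -/
def precondOp (hA : IsLInfty (toC A)) (s : Ell2 (Fin n × (Fin n × ℤ))) :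
    Ell2 (Fin n × (Fin n × ℤ)) →L[ℂ] Ell2 (Fin n × (Fin n × ℤ)) :=
  1 + diagOp s ∘L (convOp hA - 1)

/-- The solution of the Lyapunov equation preconditioned by `s`. -/
def precondSol (hA : IsLInfty (toC A)) (hQ : IsLInfty Q) (s : Ell2 (Fin n × (Fin n × ℤ))) :
    Ell2 (Fin n × (Fin n × ℤ)) :=
  Ring.inverse (precondOp hA s) (diagOp s (-colVec hQ))

/-- Uniqueness is assumed only among `L^∞` functions, so a kernel element must first be shown to
come from one: being in the range of `diagOp`, it is `ℓ¹` and synthesises a continuous function. -/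
lemma isUnit_precondOp (hA : IsLInfty (toC A))
    (huniq : ∀ P₀ : AddCircle T → Matrix (Fin n) (Fin n) ℂ,
      IsLyapSol A (fun _ => 0) P₀ → P₀ =ᵐ[haarAddCircle] fun _ => 0) :
    IsUnit (precondOp hA (resolventDiag T n)) := by
  refine (isDiagPerturbation_lyapMat hA).isUnit fun x z hxz hx => ?_
  have hsum : Summable fun p => ‖x p‖ := by
    rw [hxz]
    exact summable_norm_mul _ _
  have hcol := colPhasor_synthMat (T := T) hsum
  have h0 : colPhasor (fun _ : AddCircle T => (0 : Matrix (Fin n) (Fin n) ℂ)) = 0 := by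
    ext p
    simp [colPhasor, phasor, fourierCoeff]
  have hsol : IsLyapSol A (fun _ => 0) (synthMat (T := T) x) := by
    refine isLyapSol_of_actsTo hA (isLInfty_synthMat x) ?_
    rw [hcol, h0, neg_zero]
    exact hx
  have hP := huniq _ hsol
  ext p
  rw [← hcol]
  have hzero : (fun t => synthMat (T := T) x t p.2.1 p.1) =ᵐ[haarAddCircle] fun _ => 0 := by
    filter_upwards [hP] with t ht
    rw [ht]
    rfl
  rw [colPhasor, phasor, fourierCoeff_congr_ae hzero]
  simp [fourierCoeff]

lemma precondSol_eq (hA : IsLInfty (toC A)) (hQ : IsLInfty Q)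
    {s : Ell2 (Fin n × (Fin n × ℤ))} (hs : IsUnit (precondOp hA s)) :
    precondSol hA hQ s = diagOp s (-colVec hQ - (convOp hA - 1) (precondSol hA hQ s)) :=
  inverse_diagOp_eq s hs (-colVec hQ)

lemma summable_norm_precondSol (hA : IsLInfty (toC A)) (hQ : IsLInfty Q)
    {s : Ell2 (Fin n × (Fin n × ℤ))} (hs : IsUnit (precondOp hA s)) :
    Summable fun p => ‖precondSol hA hQ s p‖ := by
  rw [precondSol_eq hA hQ hs]
  exact summable_norm_mul _ _

lemma actsTo_precondSol (hA : IsLInfty (toC A)) (hQ : IsLInfty Q)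
    (hS : IsUnit (precondOp hA (resolventDiag T n))) :
    ActsTo (lyapMat (toeplitz (toC A)) (nMat T n)) (precondSol hA hQ (resolventDiag T n))
      (-colPhasor Q) :=
  ((isDiagPerturbation_lyapMat hA).actsTo_iff _ (-colVec hQ)).2 (apply_inverse hS _)

lemma truncPhasor_eq_precondSol (hA : IsLInfty (toC A)) (hQ : IsLInfty Q) {m : ℕ}
    (hS : IsUnit (precondOp hA (restrictTo (truncSet n m) (resolventDiag T n)))) :
    truncPhasor A Q m = precondSol hA hQ (restrictTo (truncSet n m) (resolventDiag T n)) := by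
  rw [truncPhasor_eq_extendVec, truncSol, truncLyapMat_eq_submatrix, ← Matrix.mulVec_neg]
  exact congrArg (fun x : Ell2 (Fin n × (Fin n × ℤ)) => (x : Fin n × (Fin n × ℤ) → ℂ))
    ((isDiagPerturbation_lyapMat hA).extendVec_solution (injective_truncIndex m)
    (coe_truncSet m) hS (-colVec hQ))

lemma tendsto_precondSol (hA : IsLInfty (toC A)) (hQ : IsLInfty Q)
    (hS : IsUnit (precondOp hA (resolventDiag T n))) :
    Tendsto (fun m => precondSol hA hQ (restrictTo (truncSet n m) (resolventDiag T n))) atTop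
      (𝓝 (precondSol hA hQ (resolventDiag T n))) :=
  (tendsto_solution_truncated hS (-colVec hQ)).comp tendsto_truncSet

lemma eventually_isUnit_precondOp (hA : IsLInfty (toC A))
    (hS : IsUnit (precondOp hA (resolventDiag T n))) :
    ∀ᶠ m in atTop, IsUnit (precondOp hA (restrictTo (truncSet n m) (resolventDiag T n))) :=
  tendsto_truncSet.eventually (eventually_isUnit_truncated hS)

lemma tendsto_tsum_norm_precondSol_sub (hA : IsLInfty (toC A)) (hQ : IsLInfty Q)
    (hS : IsUnit (precondOp hA (resolventDiag T n))) :
    Tendsto (fun m => ∑' p, ‖precondSol hA hQ (resolventDiag T n) p -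
      precondSol hA hQ (restrictTo (truncSet n m) (resolventDiag T n)) p‖) atTop (𝓝 0) := by
  have h1 := (tendsto_restrictTo (resolventDiag T n)).comp (tendsto_truncSet (n := n))
  have h2 := ((((convOp hA - 1).continuous.tendsto _).comp
    (tendsto_precondSol hA hQ hS)).const_sub (-colVec hQ))
  refine (tendsto_tsum_norm_mul_sub_mul h1 h2).congr' ?_
  filter_upwards [eventually_isUnit_precondOp hA hS] with m hm
  -- Both solutions are put in fixed-point form; for the truncated one this requires its operator to
  -- be a unit, hence large `m`.
  conv_rhs => rw [precondSol_eq hA hQ hS, precondSol_eq hA hQ hm]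
  rfl

end Convergence

end

end Harmonic

open Harmonic Filter Topology in
theorem mainTheorem2 {T : ℝ} [hT : Fact (0 < T)] {n : ℕ}
    (A : AddCircle T → Matrix (Fin n) (Fin n) ℝ)
    (Q : AddCircle T → Matrix (Fin n) (Fin n) ℂ)
    (hA : Harmonic.IsLInfty (Harmonic.toC A)) (hQ : Harmonic.IsLInfty Q)
    (hinv : Harmonic.IsInvertibleOp (Harmonic.toeplitz (Harmonic.toC A) - Harmonic.nMat T n))
    (huniq : ∀ P₀ : AddCircle T → Matrix (Fin n) (Fin n) ℂ,
      Harmonic.IsLyapSol A (fun _ => 0) P₀ → P₀ =ᵐ[AddCircle.haarAddCircle] fun _ => 0) :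
    ∃ P : AddCircle T → Matrix (Fin n) (Fin n) ℂ,
      Harmonic.IsLyapSol A Q P ∧
      (∀ P' : AddCircle T → Matrix (Fin n) (Fin n) ℂ,
        Harmonic.IsLyapSol A Q P' → P' =ᵐ[AddCircle.haarAddCircle] P) ∧
      Harmonic.IsInvertibleOp
        (Harmonic.lyapMat (Harmonic.toeplitz (Harmonic.toC A)) (Harmonic.nMat T n)) ∧
      Harmonic.ActsTo
        (Harmonic.lyapMat (Harmonic.toeplitz (Harmonic.toC A)) (Harmonic.nMat T n))
        (Harmonic.colPhasor P) (-Harmonic.colPhasor Q) ∧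
      ∀ ε : ℝ, 0 < ε → ∃ m₀ : ℕ, ∀ m : ℕ, m₀ ≤ m →
        IsUnit (Harmonic.truncLyapMat A m) ∧
        (∃ d : Harmonic.Ell2 (Fin n × (Fin n × ℤ)),
          (∀ p, d p = Harmonic.colPhasor P p - Harmonic.truncPhasor A Q m p) ∧ ‖d‖ < ε) ∧
        ∃ L L' : Harmonic.Ell2 (Fin n × ℤ) →L[ℂ] Harmonic.Ell2 (Fin n × ℤ),
          Harmonic.IsOperatorOf (Harmonic.toeplitz P) L ∧
          Harmonic.IsOperatorOf (Harmonic.toeplitz (Harmonic.truncFun A Q m)) L' ∧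
          ‖L - L'‖ < ε := by
  have hS := isUnit_precondOp hA huniq
  set r := resolventDiag T n with hr
  set x := precondSol hA hQ r with hx
  have hsum : Summable fun p => ‖x p‖ := summable_norm_precondSol hA hQ hS
  have hcol := colPhasor_synthMat (T := T) hsum
  have hacts : ActsTo (lyapMat (toeplitz (toC A)) (nMat T n)) (colPhasor (synthMat (T := T) x))
      (-colPhasor Q) := by
    rw [hcol]
    exact actsTo_precondSol hA hQ hS
  have hsol : IsLyapSol A Q (synthMat (T := T) x) :=
    isLyapSol_of_actsTo hA (isLInfty_synthMat x) hacts
  refine ⟨synthMat (T := T) x, hsol, fun P' hP' => ?_,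
    (isDiagPerturbation_lyapMat hA).isInvertibleOp hS, hacts, fun ε hε => ?_⟩
  · filter_upwards [huniq _ (hP'.sub hsol)] with t ht
    exact sub_eq_zero.1 ht
  have h1 := (tendsto_tsum_norm_precondSol_sub hA hQ hS).eventually_lt_const hε
  have h2 := (((tendsto_precondSol hA hQ hS).const_sub x).norm).eventually_lt_const
    (u := ε) (by simpa [hx, hr] using hε)
  obtain ⟨m₀, hm₀⟩ := eventually_atTop.1
    (h1.and (h2.and (eventually_isUnit_precondOp hA hS)))
  refine ⟨m₀, fun m hm => ?_⟩
  obtain ⟨h1, h2, hm⟩ := hm₀ m hm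
  have htr := truncPhasor_eq_precondSol hA hQ hm
  refine ⟨?_, ⟨_, fun p => ?_, h2⟩, toeplitzOp T x, toeplitzOp T (truncPhasor A Q m),
    isOperatorOf_toeplitzOp x, ?_, ?_⟩
  · rw [truncLyapMat_eq_submatrix]
    exact (isDiagPerturbation_lyapMat hA).isUnit_submatrix (injective_truncIndex m)
      (coe_truncSet m) hm
  · rw [hcol, htr]
    rfl
  · rw [truncFun_eq_synthMat]
    exact isOperatorOf_toeplitzOp _
  · refine (norm_toeplitzOp_sub_le hsum ?_).trans_lt ?_
    · rw [htr]
      exact summable_norm_precondSol hA hQ hm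
    · rw [htr]
      exact h1
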